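/- **Setting.** Fix a Kac–Moody root datum: a finite free $\mathbb{Z}$-module $P$ (the coweight lattice), linearly independent simple coroots $\alpha_i^\vee\in P$ and linearly independent simple roots $\alpha_i\in\mathrm{Hom}(P,\mathbb{Z})$ ($i\in I$) such that $(\langle\alpha_j,\alpha_i^\vee\rangle)$ is a generalized Cartan matrix. Let $W\subset GL(P)$ be the Weyl group, generated by $s_i(\mu)=\mu-\langle\alpha_i,\mu\rangle\alpha_i^\vee$; let $\Delta=W\{\alpha_i\}$ be the set of real roots and $\Delta^+$ the set of positive ones; let $\mathrm{Inv}(w)=\Delta^+\cap w^{-1}(-\Delta^+)$. Let $P^+$ be the set of dominant coweights, $\mathcal{T}=W\cdot P^+$ the Tits cone, and $W_{\mathcal{T}}=W\ltimes\mathcal{T}=\{\pi^\mu w\mid \mu\in\mathcal{T},\,w\in W\}$. Choose a $\mathbb{Q}$-valued weight $\rho$ with $\langle\rho,\alpha_i^\vee\rangle=1$ for all $i$, and an integer $N\ge 1$ with $\langle\rho,\mu\rangle\in\frac1N\mathbb{Z}$ for all $\mu\in P$. The length function $\ell:W_{\mathcal{T}}\to\frac1N\mathbb{Z}$ is $$\ell(\pi^\mu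 w)=2\langle\rho,\mu\rangle+\sum_{\eta\in\Delta^+}c_\eta,$$ where, if $\langle\eta,\mu\rangle<0$, $c_\eta=-2\langle\eta,\mu\rangle-1$ or $-2\langle\eta,\mu\rangle$ according to $\eta\in\mathrm{Inv}(w^{-1})$ or not, and, if $\langle\eta,\mu\rangle\ge0$, $c_\eta=1$ or $0$ according to $\eta\in\mathrm{Inv}(w^{-1})$ or not (only finitely many $c_\eta$ are nonzero). The Kac–Moody affine Hecke algebra $\mathcal{H}$ is the unital $\mathbb{Z}[q^{1/N},q^{-1/N}]$-algebra generated by $T_i$ ($i\in I$) and $\Theta^\mu$ ($\mu\in\mathcal{T}$) subject to $T_i^2=(q-1)T_i+q$, the braid relations of the Coxeter group $W$, $\Theta^0=1$, $\Theta^{\mu}\Theta^{\nu}=\Theta^{\mu+\nu}$, and the Bernstein relation $$T_i\Theta^\mu-\Theta^{s_i(\mu)}T_i=(q-1)\frac{\Theta^\mu-\Theta^{s_i(\mu)}}{1-\Theta^{-\alpha_i^\vee}}.$$ Each $T_i$ is invertible in $\mathcal{H}$. For $w\in W$ put $T_w=T_{j_1}\cdots T_{j_m}$ for a reduced decomposition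 $w=s_{j_1}\cdots s_{j_m}$. For $x\in W_{\mathcal{T}}$ write $x=\pi^{w(\lambda)}v$ with $\lambda\in P^+$, $w,v\in W$, choose any decomposition $v=s_{i_1}\cdots s_{i_r}$, and put $$T_x=q^{\langle\rho,\lambda\rangle}\,T_{w^{-1}}^{-1}\,\Theta^\lambda\,T_{w^{-1}}\,T_{i_1}^{\varepsilon_1}\cdots T_{i_r}^{\varepsilon_r}.$$ Here $\varepsilon_k=1$ if $\pi^{w(\lambda)}s_{i_1}\cdots s_{i_{k-1}}(\alpha_{i_k})$ is a positive affine root and $\varepsilon_k=-1$ otherwise, where $\pi^\mu u(\beta+n\pi)=u(\beta)+(n+\langle u(\beta),\mu\rangle)\pi$ and $\beta+n\pi$ is positive if $\beta\in\Delta^+$, $n\ge0$ or $-\beta\in\Delta^+$, $n>0$. **Theorem.** There is a unique $\mathbb{Z}[q^{1/N},q^{-1/N}]$-algebra map $$\mathrm{triv}:\mathcal{H}\to\mathbb{Z}[q^{1/N},q^{-1/N}]$$ with $T_i\mapsto q$ for all $i\in I$ and $\Theta^\mu\mapsto q^{\langle\rho,\mu\rangle}$ for all $\mu\in\mathcal{T}$.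 For every $x\in W_{\mathcal{T}}$ one has $\ell(x)\in\frac1N\mathbb{Z}$ and $$\mathrm{triv}(T_x)=q^{\ell(x)},$$ whichever decompositions are used to write $T_x$; in particular $\ell(x)$ is the only $r\in\frac1N\mathbb{Z}$ with $\mathrm{triv}(T_x)=q^{r}$, so the length function is recovered from $\mathcal{H}$ and its $T$-basis. -/

import Mathlib

noncomputable section

open scoped LaurentPolynomial

universe u v

/-- A (free) Kac-Moody root datum with Dynkin diagram `I` and coweight lattice `P`. Its weight
lattice is `Hom(P, ℤ)`, and `⟨β, μ⟩` is the evaluation `β μ`. The matrix `⟨α_j, α_i^∨⟩` is a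
generalized Cartan matrix; simple roots and simple coroots are linearly independent. -/
structure KMRootDatum (I : Type u) (P : Type v) [AddCommGroup P] where
  simpleRoot : I → Module.Dual ℤ P
  simpleCoroot : I → P
  root_coroot_two : ∀ i, simpleRoot i (simpleCoroot i) = 2
  root_coroot_nonpos : ∀ i j, i ≠ j → simpleRoot j (simpleCoroot i) ≤ 0
  root_coroot_zero : ∀ i j, simpleRoot j (simpleCoroot i) = 0 → simpleRoot i (simpleCoroot j) = 0
  linearIndependent_root : LinearIndependent ℤ simpleRoot
  linearIndependent_coroot : LinearIndependent ℤ simpleCoroot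

namespace KMRootDatum

variable {I : Type u} {P : Type v} [AddCommGroup P] (D : KMRootDatum I P)

/-- The simple reflection `s_i(μ) = μ - ⟨α_i, μ⟩ α_i^∨` of the coweight lattice. -/
def reflection (i : I) : P ≃ₗ[ℤ] P :=
  Module.reflection (D.root_coroot_two i)

/-- The Weyl group, acting (faithfully) on the coweight lattice. -/
def weylGroup : Subgroup (P ≃ₗ[ℤ] P) :=
  Subgroup.closure (Set.range D.reflection)

/-- The simple reflection `s_i` as an element of the Weyl group. -/
def s (i : I) : D.weylGroup :=
  ⟨D.reflection i, Subgroup.subset_closure ⟨i, rfl⟩⟩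

/-- The action of the Weyl group on weights: `⟨w(β), μ⟩ = ⟨β, w⁻¹(μ)⟩`. -/
def act (w : D.weylGroup) (β : Module.Dual ℤ P) : Module.Dual ℤ P :=
  β ∘ₗ ((w⁻¹ : D.weylGroup) : P ≃ₗ[ℤ] P).toLinearMap

/-- The real roots `Δ = W · {α_i}`. -/
def realRoots : Set (Module.Dual ℤ P) :=
  {β | ∃ (w : D.weylGroup) (i : I), β = D.act w (D.simpleRoot i)}

/-- The positive real roots `Δ⁺`: those that are sums of simple roots. -/
def posRoots : Set (Module.Dual ℤ P) :=
  {β | β ∈ D.realRoots ∧ β ∈ AddSubmonoid.closure (Set.range D.simpleRoot)}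

/-- The inversion set `Inv(w) = Δ⁺ ∩ w⁻¹(-Δ⁺)`. -/
def inv (w : D.weylGroup) : Set (Module.Dual ℤ P) :=
  {β | β ∈ D.posRoots ∧ -(D.act w β) ∈ D.posRoots}

/-- The dominant coweights `P⁺`. -/
def dominant : Set P :=
  {lam | ∀ i, 0 ≤ D.simpleRoot i lam}

/-- The Tits cone `𝒯 = W · P⁺` in the coweight lattice. -/
def titsCone : Set P :=
  {μ | ∃ (w : D.weylGroup) (lam : P), lam ∈ D.dominant ∧ μ = (w : P ≃ₗ[ℤ] P) lam}

/-- The product `s_{i_1} ⋯ s_{i_r}` of a word `[i_1, …, i_r]` in the simple reflections. -/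
def wordProd (l : List I) : D.weylGroup :=
  (l.map D.s).prod

/-- A word is reduced if no shorter word has the same product. -/
def IsReduced (l : List I) : Prop :=
  ∀ l' : List I, D.wordProd l' = D.wordProd l → l.length ≤ l'.length

/-- The element `β + nπ` is encoded as `(β, n)`. This is the set of positive Kac-Moody affine
roots: `β ∈ Δ⁺` and `n ≥ 0`, or `β ∈ -Δ⁺` and `n > 0`. -/
def posAffineRoots : Set (Module.Dual ℤ P × ℤ) :=
  {b | (b.1 ∈ D.posRoots ∧ 0 ≤ b.2) ∨ (-b.1 ∈ D.posRoots ∧ 0 < b.2)}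

/-- The action `π^μ w (β + nπ) = w(β) + (n + ⟨μ, w(β)⟩)π` on affine roots. -/
def affineAct (μ : P) (w : D.weylGroup) (b : Module.Dual ℤ P × ℤ) : Module.Dual ℤ P × ℤ :=
  (D.act w b.1, b.2 + D.act w b.1 μ)

/-- The elements `π^μ w` of `W_𝒯 = W ⋉ 𝒯`. -/
@[ext]
structure TitsWeyl where
  μ : P
  w : D.weylGroup
  mem : μ ∈ D.titsCone

/-- A choice of a weight `ρ`, with rational values, such that `⟨ρ, α_i^∨⟩ = 1` for all `i`, and
of an integer `N ≥ 1` with `⟨ρ, μ⟩ ∈ (1/N)ℤ` for all coweights `μ`. -/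
structure RhoChoice where
  ρ : P →ₗ[ℤ] ℚ
  N : ℕ
  one_le_N : 1 ≤ N
  ρ_coroot : ∀ i, ρ (D.simpleCoroot i) = 1
  ρ_mem : ∀ μ, ρ μ ∈ AddSubgroup.zmultiples ((N : ℚ)⁻¹)

/-- The summand of the length function of `π^μ w` at the positive real root `η`. -/
def lengthTerm (μ : P) (w : D.weylGroup) (η : Module.Dual ℤ P) : ℤ :=
  open Classical in
  if η μ < 0 then
    if η ∈ D.inv w⁻¹ then -(2 * η μ) - 1 else -(2 * η μ)
  else
    if η ∈ D.inv w⁻¹ then 1 else 0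

variable {D} in
/-- The length function
`ℓ(π^μ w) = 2⟨ρ, μ⟩ + ∑_{η ∈ Δ⁺} …`. For `μ` in the Tits cone only finitely many summands are
nonzero. -/
def RhoChoice.length (R : D.RhoChoice) (x : D.TitsWeyl) : ℚ :=
  2 * R.ρ x.μ + ((∑ᶠ η ∈ D.posRoots, D.lengthTerm x.μ x.w η : ℤ) : ℚ)

end KMRootDatum

namespace KMHecke

open KMRootDatum

/-- The power `q^r` for `r ∈ (1/N)ℤ`, in the Laurent polynomial ring `ℤ[t, t⁻¹]` where the
variable `t` is `q^{1/N}`. (It is used only for `r ∈ (1/N)ℤ`, where `N * r` is an integer.) -/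
def qPow (N : ℕ) (r : ℚ) : ℤ[T;T⁻¹] :=
  LaurentPolynomial.T ⌊(N : ℚ) * r⌋

/-- The parameter `q = (q^{1/N})^N`. -/
def q (N : ℕ) : ℤ[T;T⁻¹] :=
  LaurentPolynomial.T (N : ℤ)

/-- The inverse of `q`. -/
def qInv (N : ℕ) : ℤ[T;T⁻¹] :=
  LaurentPolynomial.T (-(N : ℤ))

theorem q_mul_qInv (N : ℕ) : q N * qInv N = 1 := by
  rw [q, qInv, ← LaurentPolynomial.T_add, add_neg_cancel, LaurentPolynomial.T_zero]

variable {I : Type u} {P : Type v} [AddCommGroup P] (D : KMRootDatum I P)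

/-- The free `ℤ[q^{±1/N}]`-algebra on generators `T_i` (`i ∈ I`) and `Θ^μ` (`μ ∈ 𝒯`). -/
abbrev Free : Type (max u v) :=
  FreeAlgebra ℤ[T;T⁻¹] (I ⊕ D.titsCone)

/-- The generator `T_i`. -/
def freeT (i : I) : Free D :=
  FreeAlgebra.ι _ (Sum.inl i)

/-- The generator `Θ^μ`, for `μ ∈ 𝒯`. The value `0` outside of `𝒯` is never reached in the
relations below, as `𝒯` is closed under addition, contains `0`, and contains every `μ - k α_i^∨`
between `μ ∈ 𝒯` and `s_i(μ)`. -/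
def freeΘ (μ : P) : Free D :=
  open Classical in
  if h : μ ∈ D.titsCone then FreeAlgebra.ι _ (Sum.inr ⟨μ, h⟩) else 0

/-- The quotient `(Θ^μ - Θ^{s_i(μ)}) / (1 - Θ^{-α_i^∨})`. With `n = ⟨α_i, μ⟩`, it is
`Θ^μ + Θ^{μ - α_i^∨} + ⋯ + Θ^{μ - (n-1)α_i^∨}` if `n ≥ 0`, and it is
`-(Θ^ν + Θ^{ν - α_i^∨} + ⋯ + Θ^{ν - (-n-1)α_i^∨})` with `ν = s_i(μ)` if `n ≤ 0`. -/
def bernsteinQuotient (i : I) (μ : P) : Free D :=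
  ∑ k ∈ Finset.range (D.simpleRoot i μ).toNat, freeΘ D (μ - k • D.simpleCoroot i) -
  ∑ k ∈ Finset.range (-(D.simpleRoot i μ)).toNat,
    freeΘ D (D.reflection i μ - k • D.simpleCoroot i)

/-- The defining relations of the Kac-Moody affine Hecke algebra. In the braid relations, the order
of `s_i s_j` in the Weyl group is the entry of the Coxeter matrix, and both sides are alternating
words of that length (they are empty if the order is infinite, `orderOf` being `0` then). -/
inductive Rel (N : ℕ) : Free D → Free D → Prop
  | quadratic (i : I) :
      Rel N (freeT D i * freeT D i) ((q N - 1) • freeT D i + q N • 1)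
  | braid (i j : I) :
      Rel N
        ((CoxeterSystem.alternatingWord i j (orderOf (D.s i * D.s j))).map (freeT D)).prod
        ((CoxeterSystem.alternatingWord j i (orderOf (D.s i * D.s j))).map (freeT D)).prod
  | theta_zero : Rel N (freeΘ D 0) 1
  | theta_add (μ ν : P) (hμ : μ ∈ D.titsCone) (hν : ν ∈ D.titsCone) :
      Rel N (freeΘ D μ * freeΘ D ν) (freeΘ D (μ + ν))
  | bernstein (i : I) (μ : P) (hμ : μ ∈ D.titsCone) :
      Rel N (freeT D i * freeΘ D μ - freeΘ D (D.reflection i μ) * freeT D i)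
        ((q N - 1) • bernsteinQuotient D i μ)

/-- The Kac-Moody affine Hecke algebra `ℋ`, in its Bernstein presentation over `ℤ[q^{±1/N}]`. -/
abbrev Hecke (N : ℕ) : Type (max u v) :=
  RingQuot (Rel D N)

/-- `T_i` in `ℋ`. -/
def heckeT (N : ℕ) (i : I) : Hecke D N :=
  RingQuot.mkAlgHom ℤ[T;T⁻¹] (Rel D N) (freeT D i)

/-- `Θ^μ` in `ℋ`, for `μ ∈ 𝒯`. -/
def heckeΘ (N : ℕ) (μ : P) : Hecke D N :=
  RingQuot.mkAlgHom ℤ[T;T⁻¹] (Rel D N) (freeΘ D μ)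

theorem heckeT_mul_self (N : ℕ) (i : I) :
    heckeT D N i * heckeT D N i = (q N - 1) • heckeT D N i + q N • 1 := by
  have h := RingQuot.mkAlgHom_rel ℤ[T;T⁻¹] (Rel.quadratic (D := D) (N := N) i)
  rwa [map_mul, map_add, map_smul, map_smul, map_one] at h

/-- `T_i` as a unit of `ℋ`, with inverse `q⁻¹ T_i + (q⁻¹ - 1)`. -/
def unitT (N : ℕ) (i : I) : (Hecke D N)ˣ where
  val := heckeT D N i
  inv := qInv N • heckeT D N i + (qInv N - 1) • 1
  val_inv := by
    have h : qInv N * (q N - 1) + (qInv N - 1) = 0 := by linear_combination q_mul_qInv N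
    rw [mul_add, mul_smul_comm, mul_smul_comm, mul_one, heckeT_mul_self, smul_add, smul_smul,
      smul_smul, add_right_comm, ← add_smul, h, zero_smul, zero_add, mul_comm, q_mul_qInv, one_smul]
  inv_val := by
    have h : qInv N * (q N - 1) + (qInv N - 1) = 0 := by linear_combination q_mul_qInv N
    rw [add_mul, smul_mul_assoc, smul_mul_assoc, one_mul, heckeT_mul_self, smul_add, smul_smul,
      smul_smul, add_right_comm, ← add_smul, h, zero_smul, zero_add, mul_comm, q_mul_qInv, one_smul]

/-- The product `T_{i_1} ⋯ T_{i_r}` of a word; this is `T_w` if the word is reduced with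
product `w`. -/
def wordT (N : ℕ) (l : List I) : (Hecke D N)ˣ :=
  (l.map (unitT D N)).prod

/-- The sign `ε = ±1`, according to `π^μ u (α_i)` being a positive affine root or not. -/
def sgn (μ : P) (u : D.weylGroup) (i : I) : ℤ :=
  open Classical in
  if D.affineAct μ u (D.simpleRoot i, 0) ∈ D.posAffineRoots then 1 else -1

/-- The product `T_{i_1}^{ε_1} ⋯ T_{i_r}^{ε_r}`, where `ε_k` is `1` or `-1` according to
`π^μ u s_{i_1} ⋯ s_{i_{k-1}} (α_{i_k})` being a positive affine root or not. -/
def signedWordT (N : ℕ) (μ : P) : D.weylGroup → List I → (Hecke D N)ˣ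
  | _, [] => 1
  | u, i :: l => unitT D N i ^ sgn D μ u i * signedWordT N μ (u * D.s i) l

variable {D}

/-- The data in the formula for a `T`-basis element: `x = π^{w(λ)} v` with `λ` dominant, a reduced
decomposition of `w⁻¹`, and an arbitrary decomposition of `v`, into simple reflections. -/
structure Decomposition (x : D.TitsWeyl) where
  lam : P
  w : D.weylGroup
  dominant : lam ∈ D.dominant
  μ_eq : x.μ = (w : P ≃ₗ[ℤ] P) lam
  wordInv : List I
  wordInv_reduced : D.IsReduced wordInv
  wordInv_prod : D.wordProd wordInv = w⁻¹
  word : List I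
  word_prod : D.wordProd word = x.w

/-- The element
`T_{π^{w(λ)} v} = q^{⟨ρ, λ⟩} T_{w⁻¹}⁻¹ Θ^λ T_{w⁻¹} T_{i_1}^{ε_1} ⋯ T_{i_r}^{ε_r}` of `ℋ`. -/
def Decomposition.elem (R : D.RhoChoice) {x : D.TitsWeyl} (d : Decomposition x) : Hecke D R.N :=
  qPow R.N (R.ρ d.lam) •
    (((wordT D R.N d.wordInv)⁻¹ : (Hecke D R.N)ˣ) * heckeΘ D R.N d.lam * wordT D R.N d.wordInv *
      signedWordT D R.N x.μ 1 d.word)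

variable (D) in
theorem exists_word (w : D.weylGroup) : ∃ l, D.wordProd l = w := by
  obtain ⟨w, hw⟩ := w
  have hs : ∀ i, D.s i * D.s i = 1 := fun i => Subtype.ext (LinearEquiv.ext fun y =>
    Module.involutive_reflection (D.root_coroot_two i) y)
  induction hw using Subgroup.closure_induction with
  | mem x hx =>
    obtain ⟨i, rfl⟩ := hx
    exact ⟨[i], by simp [KMRootDatum.wordProd, KMRootDatum.s]⟩
  | one => exact ⟨[], rfl⟩
  | mul x y hx hy ihx ihy =>
    obtain ⟨a, ha⟩ := ihx
    obtain ⟨b, hb⟩ := ihy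
    refine ⟨a ++ b, ?_⟩
    rw [KMRootDatum.wordProd, List.map_append, List.prod_append]
    change D.wordProd a * D.wordProd b = _
    rw [ha, hb]
    rfl
  | inv x hx ih =>
    obtain ⟨a, ha⟩ := ih
    refine ⟨a.reverse, ?_⟩
    have key : ∀ l : List I, D.wordProd l.reverse = (D.wordProd l)⁻¹ := by
      intro l
      induction l with
      | nil => simp [KMRootDatum.wordProd]
      | cons i l ih =>
        simp only [KMRootDatum.wordProd, List.reverse_cons, List.map_append, List.map_cons,
          List.map_nil, List.prod_append, List.prod_cons, List.prod_nil, mul_one,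
          mul_inv_rev] at ih ⊢
        rw [ih, ← eq_inv_of_mul_eq_one_left (hs i)]
    rw [key, ha]
    rfl

variable (D) in
theorem exists_reduced_word (w : D.weylGroup) : ∃ l, D.IsReduced l ∧ D.wordProd l = w := by
  classical
  have h : ∃ n, ∃ l : List I, l.length = n ∧ D.wordProd l = w := by
    obtain ⟨l, hl⟩ := exists_word D w
    exact ⟨_, l, rfl, hl⟩
  obtain ⟨l, hl, hw⟩ := Nat.find_spec h
  refine ⟨l, fun l' hl' => ?_, hw⟩
  rw [hl]
  exact Nat.find_min' h ⟨l', rfl, hl'.trans hw⟩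

theorem nonempty_decomposition (x : D.TitsWeyl) : Nonempty (Decomposition x) := by
  obtain ⟨w, lam, hl, hx⟩ := x.mem
  obtain ⟨a, ha, haw⟩ := exists_reduced_word D w⁻¹
  obtain ⟨b, hb⟩ := exists_word D x.w
  exact ⟨⟨lam, w, hl, hx, a, ha, haw, b, hb⟩⟩

/-- The `T`-basis element `T_x`, computed from some decomposition of `x`. -/
def basisT (R : D.RhoChoice) (x : D.TitsWeyl) : Hecke D R.N :=
  (Classical.choice (nonempty_decomposition x)).elem R

end KMHecke

end

noncomputable section

open scoped LaurentPolynomial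

universe u v

namespace KMRootDatum

variable {I : Type u} {P : Type v} [AddCommGroup P] (D : KMRootDatum I P)

open CoxeterSystem (alternatingWord alternatingWord_succ alternatingWord_succ'
  length_alternatingWord)

/-! ### The Weyl group acting on weights -/

/-! Only the Bernstein relation tests whether the character exists. Since `ρ` takes the value 1 on
simple coroots, the Bernstein quotient becomes a geometric series, and both sides equal `q (q^⟨ρ,μ⟩
- q^⟨ρ,s_i μ⟩)`. This requires the whole coroot string between `μ` and `s_i μ` to lie in the Tits
cone, which follows from describing the cone by finiteness of the set of positive real roots
negative at `μ` (`mem_titsCone_iff`).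

The target is commutative, so in `T_x` the conjugation by `T_{w⁻¹}` disappears and the image is `q`
to the power `2⟨ρ,λ⟩ + ∑ ε_k`. The length splits in the same way (`finsum_lengthTerm`) as `2(⟨ρ,μ⟩ +
negSum μ) + signSum μ v`. The bracket is invariant under the Weyl group, hence equal to `⟨ρ,λ⟩`
(`ρ_add_negSum`). Appending a letter to a word changes the inversion set by one root and `signSum`
by exactly `ε_k` (`signSum_mul_s`), for any decomposition of `v`.

All this rests on two facts about real roots: each is positive or negative, and `s_i` permutes the
positive ones other than `α_i`. The first is proved from the Cartan matrix by reduction to rank two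
(`act_simpleRoot_mem_posCone`). -/

theorem reflection_apply (i : I) (μ : P) :
    D.reflection i μ = μ - D.simpleRoot i μ • D.simpleCoroot i :=
  Module.reflection_apply _ _

theorem reflection_reflection (i : I) (μ : P) : D.reflection i (D.reflection i μ) = μ :=
  Module.involutive_reflection (D.root_coroot_two i) μ

@[simp]
theorem coe_s (i : I) : (D.s i : P ≃ₗ[ℤ] P) = D.reflection i := rfl

theorem s_mul_s (i : I) : D.s i * D.s i = 1 :=
  Subtype.ext (LinearEquiv.ext (D.reflection_reflection i))

theorem s_inv (i : I) : (D.s i)⁻¹ = D.s i :=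
  inv_eq_of_mul_eq_one_left (D.s_mul_s i)

theorem mul_s_mul_s (w : D.weylGroup) (i : I) : w * D.s i * D.s i = w := by
  rw [mul_assoc, s_mul_s, mul_one]

theorem act_apply (w : D.weylGroup) (β : Module.Dual ℤ P) (μ : P) :
    D.act w β μ = β (((w⁻¹ : D.weylGroup) : P ≃ₗ[ℤ] P) μ) := rfl

@[simp]
theorem act_one (β : Module.Dual ℤ P) : D.act 1 β = β := by
  ext μ
  simp [act_apply]

theorem act_mul (u w : D.weylGroup) (β : Module.Dual ℤ P) :
    D.act (u * w) β = D.act u (D.act w β) := by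
  ext μ
  simp only [act_apply, mul_inv_rev]
  rfl

theorem act_add (w : D.weylGroup) (β γ : Module.Dual ℤ P) :
    D.act w (β + γ) = D.act w β + D.act w γ := rfl

theorem act_neg (w : D.weylGroup) (β : Module.Dual ℤ P) : D.act w (-β) = -D.act w β := rfl

theorem act_zsmul (w : D.weylGroup) (n : ℤ) (β : Module.Dual ℤ P) :
    D.act w (n • β) = n • D.act w β := rfl

@[simp]
theorem act_inv_act (w : D.weylGroup) (β : Module.Dual ℤ P) : D.act w⁻¹ (D.act w β) = β := by
  rw [← act_mul, inv_mul_cancel, act_one]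

@[simp]
theorem act_act_inv (w : D.weylGroup) (β : Module.Dual ℤ P) : D.act w (D.act w⁻¹ β) = β := by
  rw [← act_mul, mul_inv_cancel, act_one]

theorem act_s (i : I) (β : Module.Dual ℤ P) :
    D.act (D.s i) β = β - β (D.simpleCoroot i) • D.simpleRoot i := by
  ext μ
  rw [act_apply, s_inv, coe_s, reflection_apply]
  simp [mul_comm]

theorem act_s_act_s (i : I) (β : Module.Dual ℤ P) : D.act (D.s i) (D.act (D.s i) β) = β := by
  rw [← act_mul, s_mul_s, act_one]

theorem act_s_simpleRoot (i : I) : D.act (D.s i) (D.simpleRoot i) = -D.simpleRoot i := by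
  rw [act_s, root_coroot_two, two_smul]
  abel

theorem act_s_apply (i : I) (β : Module.Dual ℤ P) (μ : P) :
    D.act (D.s i) β μ = β (D.reflection i μ) := by
  rw [act_apply, s_inv, coe_s]

/-! ### Word length -/

@[simp]
theorem wordProd_nil : D.wordProd [] = 1 := rfl

@[simp]
theorem wordProd_cons (i : I) (l : List I) : D.wordProd (i :: l) = D.s i * D.wordProd l := by
  simp [wordProd]

theorem wordProd_append (l l' : List I) :
    D.wordProd (l ++ l') = D.wordProd l * D.wordProd l' := by
  simp [wordProd]

theorem wordProd_concat (l : List I) (i : I) :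
    D.wordProd (l.concat i) = D.wordProd l * D.s i := by
  simp [wordProd]

/-- The word length of an element of the Weyl group. -/
def wordLength (w : D.weylGroup) : ℕ :=
  sInf (List.length '' {l | D.wordProd l = w})

theorem wordLength_wordProd_le (l : List I) : D.wordLength (D.wordProd l) ≤ l.length :=
  Nat.sInf_le ⟨l, rfl, rfl⟩

theorem exists_length_eq_wordLength (w : D.weylGroup) :
    ∃ l, D.wordProd l = w ∧ l.length = D.wordLength w := by
  obtain ⟨l, hl⟩ := KMHecke.exists_word D w
  exact Nat.sInf_mem (s := List.length '' {l | D.wordProd l = w}) ⟨_, l, hl, rfl⟩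

theorem wordLength_mul_le (u w : D.weylGroup) :
    D.wordLength (u * w) ≤ D.wordLength u + D.wordLength w := by
  obtain ⟨l, rfl, hl⟩ := D.exists_length_eq_wordLength u
  obtain ⟨l', rfl, hl'⟩ := D.exists_length_eq_wordLength w
  rw [← wordProd_append, ← hl, ← hl', ← List.length_append]
  exact D.wordLength_wordProd_le _

/-! ### Rank two -/

/-- The braid relation turns an alternating word with `m + 1` letters into one with a repeated last
letter, which cancels down to `m - 1` letters. Each further letter adds at most one to the length.
-/
theorem wordLength_alternatingWord_lt {i j : I} {m : ℕ} (hm : 1 ≤ m)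
    (h : D.wordProd (alternatingWord i j m) = D.wordProd (alternatingWord j i m))
    {n : ℕ} (hn : m ≤ n) : D.wordLength (D.wordProd (alternatingWord j i (n + 1))) < n := by
  induction n, hn using Nat.le_induction with
  | base =>
    obtain ⟨k, rfl⟩ := Nat.exists_eq_add_of_le' hm
    have e : D.wordProd (alternatingWord j i (k + 1 + 1)) = D.wordProd (alternatingWord i j k) := by
      rw [alternatingWord_succ, wordProd_concat, h, alternatingWord_succ, wordProd_concat,
        mul_s_mul_s]
    rw [e]
    exact (D.wordLength_wordProd_le _).trans_lt (by simp)
  | succ n hn ih =>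
    rw [alternatingWord_succ', wordProd_cons]
    refine (D.wordLength_mul_le _ _).trans_lt ?_
    have := D.wordLength_wordProd_le [if Even (n + 1) then i else j]
    rw [wordProd_cons, wordProd_nil, mul_one, List.length_singleton] at this
    omega

/-- The coefficients of `⋯ s_i s_j (α_i)` in `α_i`, `α_j`, where `a = -⟨α_j, α_i^∨⟩` and
`b = -⟨α_i, α_j^∨⟩`. -/
def altCoeff (a b : ℤ) : ℕ → ℤ × ℤ
  | 0 => (1, 0)
  | n + 1 =>
    if Even n then ((altCoeff a b n).1, b * (altCoeff a b n).1 - (altCoeff a b n).2)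
    else (a * (altCoeff a b n).2 - (altCoeff a b n).1, (altCoeff a b n).2)

theorem act_alternatingWord (i j : I) (n : ℕ) :
    D.act (D.wordProd (alternatingWord i j n)) (D.simpleRoot i) =
      (altCoeff (-D.simpleRoot j (D.simpleCoroot i)) (-D.simpleRoot i (D.simpleCoroot j)) n).1 •
        D.simpleRoot i +
      (altCoeff (-D.simpleRoot j (D.simpleCoroot i)) (-D.simpleRoot i (D.simpleCoroot j)) n).2 •
        D.simpleRoot j := by
  induction n with
  | zero => simp [alternatingWord, altCoeff]
  | succ n ih =>
    rw [alternatingWord_succ', wordProd_cons, act_mul, ih, altCoeff]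
    split_ifs with h
    · rw [act_s]
      simp only [LinearMap.add_apply, LinearMap.smul_apply, root_coroot_two, smul_eq_mul]
      module
    · rw [act_s]
      simp only [LinearMap.add_apply, LinearMap.smul_apply, root_coroot_two, smul_eq_mul]
      module

/-- The induction needs a stronger invariant: the coefficient about to be replaced is at most half
of the sum it is subtracted from, so it does not decrease. The bound `4 ≤ a * b` carries this
invariant over to the other coefficient. -/
theorem altCoeff_nonneg_of_four_le {a b : ℤ} (ha : 0 ≤ a) (hb : 0 ≤ b) (hab : 4 ≤ a * b) (n : ℕ) :
    0 ≤ (altCoeff a b n).1 ∧ 0 ≤ (altCoeff a b n).2 := by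
  suffices h : (0 ≤ (altCoeff a b n).1 ∧ 0 ≤ (altCoeff a b n).2) ∧
      if Even n then 2 * (altCoeff a b n).2 ≤ b * (altCoeff a b n).1
      else 2 * (altCoeff a b n).1 ≤ a * (altCoeff a b n).2 from h.1
  induction n with
  | zero => simpa [altCoeff] using hb
  | succ n ih =>
    obtain ⟨⟨hx, hy⟩, h⟩ := ih
    rw [altCoeff]
    generalize (altCoeff a b n).1 = x at *
    generalize (altCoeff a b n).2 = y at *
    by_cases hn : Even n
    · simp only [hn, if_true, Nat.even_add_one, not_true_eq_false, if_false] at h ⊢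
      refine ⟨⟨hx, by nlinarith⟩, ?_⟩
      nlinarith [mul_le_mul_of_nonneg_left h ha, mul_le_mul_of_nonneg_right hab hx]
    · simp only [hn, if_true, Nat.even_add_one, not_false_eq_true, if_false] at h ⊢
      refine ⟨⟨by nlinarith, hy⟩, ?_⟩
      nlinarith [mul_le_mul_of_nonneg_left h hb, mul_le_mul_of_nonneg_right hab hy]

theorem braid_of_mul_lt_four {i j : I} (hij : i ≠ j)
    (h : D.simpleRoot j (D.simpleCoroot i) * D.simpleRoot i (D.simpleCoroot j) < 4) :
    ∃ m, 1 ≤ m ∧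
      D.wordProd (alternatingWord i j m) = D.wordProd (alternatingWord j i m) ∧
      ∀ n < m,
        0 ≤ (altCoeff (-D.simpleRoot j (D.simpleCoroot i))
          (-D.simpleRoot i (D.simpleCoroot j)) n).1 ∧
        0 ≤ (altCoeff (-D.simpleRoot j (D.simpleCoroot i))
          (-D.simpleRoot i (D.simpleCoroot j)) n).2 := by
  have ha := D.root_coroot_nonpos i j hij
  have hb := D.root_coroot_nonpos j i hij.symm
  have hab := D.root_coroot_zero i j
  have hba := D.root_coroot_zero j i
  have hi := D.root_coroot_two i
  have hj := D.root_coroot_two j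
  obtain ⟨a, ea⟩ : ∃ a, D.simpleRoot j (D.simpleCoroot i) = a := ⟨_, rfl⟩
  obtain ⟨b, eb⟩ : ∃ b, D.simpleRoot i (D.simpleCoroot j) = b := ⟨_, rfl⟩
  simp only [ea, eb] at h ha hb hab hba ⊢
  -- These are the finite rank two types A₁×A₁, A₂, B₂ and G₂, with `m` the order of `s_i s_j`.
  have key : ∃ m, (m = 2 ∧ a = 0 ∧ b = 0) ∨ (m = 3 ∧ a = -1 ∧ b = -1) ∨
      (m = 4 ∧ a = -1 ∧ b = -2) ∨ (m = 4 ∧ a = -2 ∧ b = -1) ∨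
      (m = 6 ∧ a = -1 ∧ b = -3) ∨ (m = 6 ∧ a = -3 ∧ b = -1) := by
    by_cases h0 : a = 0
    · exact ⟨2, Or.inl ⟨rfl, h0, hab h0⟩⟩
    · have hb0 : b ≠ 0 := fun e => h0 (hba e)
      have ha1 : a ≤ -1 := by omega
      have hb1 : b ≤ -1 := by omega
      have ha3 : -3 ≤ a := by nlinarith
      have hb3 : -3 ≤ b := by nlinarith
      clear ea eb hab hba
      interval_cases a <;> interval_cases b <;> simp_all
  obtain ⟨m, hm⟩ := key
  refine ⟨m, by omega, ?_, fun n hn => ?_⟩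
  · rcases hm with ⟨rfl, rfl, rfl⟩ | ⟨rfl, rfl, rfl⟩ | ⟨rfl, rfl, rfl⟩ | ⟨rfl, rfl, rfl⟩ |
      ⟨rfl, rfl, rfl⟩ | ⟨rfl, rfl, rfl⟩ <;>
    · refine Subtype.ext (LinearEquiv.ext fun μ => ?_)
      simp only [alternatingWord, wordProd_concat, wordProd_nil, one_mul, Subgroup.coe_mul, coe_s,
        LinearEquiv.mul_apply, reflection_apply, map_sub, map_smul, ea, eb, hi, hj]
      module
  · rcases hm with ⟨rfl, rfl, rfl⟩ | ⟨rfl, rfl, rfl⟩ | ⟨rfl, rfl, rfl⟩ | ⟨rfl, rfl, rfl⟩ |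
      ⟨rfl, rfl, rfl⟩ | ⟨rfl, rfl, rfl⟩ <;>
    · interval_cases n <;> decide

/-- In finite type the length hypothesis forces `n < m`, where the coefficients are known. It leaves
a slack of one, as the word has `n + 1` letters, so no parity of the length is needed. -/
theorem altCoeff_nonneg {i j : I} (hij : i ≠ j) {n : ℕ}
    (hn : n ≤ D.wordLength (D.wordProd (alternatingWord j i (n + 1)))) :
    0 ≤ (altCoeff (-D.simpleRoot j (D.simpleCoroot i))
      (-D.simpleRoot i (D.simpleCoroot j)) n).1 ∧
    0 ≤ (altCoeff (-D.simpleRoot j (D.simpleCoroot i))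
      (-D.simpleRoot i (D.simpleCoroot j)) n).2 := by
  have ha := D.root_coroot_nonpos i j hij
  have hb := D.root_coroot_nonpos j i hij.symm
  rcases le_or_gt 4 (D.simpleRoot j (D.simpleCoroot i) * D.simpleRoot i (D.simpleCoroot j))
    with h | h
  · exact altCoeff_nonneg_of_four_le (by omega) (by omega) (by rwa [neg_mul_neg]) n
  · obtain ⟨m, hm, hbraid, hlt⟩ := D.braid_of_mul_lt_four hij h
    refine hlt n (lt_of_not_ge fun hmn => ?_)
    exact absurd hn (not_le.mpr (D.wordLength_alternatingWord_lt hm hbraid hmn))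

/-! ### Positivity of roots -/

/-- The submonoid generated by the simple roots. -/
def posCone : AddSubmonoid (Module.Dual ℤ P) :=
  AddSubmonoid.closure (Set.range D.simpleRoot)

theorem simpleRoot_mem_posCone (i : I) : D.simpleRoot i ∈ D.posCone :=
  AddSubmonoid.subset_closure ⟨i, rfl⟩

theorem zsmul_mem_posCone {n : ℤ} (hn : 0 ≤ n) {β : Module.Dual ℤ P} (hβ : β ∈ D.posCone) :
    n • β ∈ D.posCone := by
  lift n to ℕ using hn
  rw [natCast_zsmul]
  exact AddSubmonoid.nsmul_mem _ hβ n

/-- Split off from the right of `w` the longest alternating word in `s_i`, `s_j` ending in `s_j`,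
with lengths adding: `w = v * a`. Then neither `s_i` nor `s_j` shortens `v`, so `v(α_i)` and
`v(α_j)` are positive by induction. Moreover `a(α_i)` is a nonnegative combination of `α_i` and
`α_j` by the rank two case. -/
theorem act_simpleRoot_mem_posCone (w : D.weylGroup) (i : I)
    (h : D.wordLength w ≤ D.wordLength (w * D.s i)) :
    D.act w (D.simpleRoot i) ∈ D.posCone := by
  classical
  induction hL : D.wordLength w using Nat.strong_induction_on generalizing w i with
  | _ L ih =>
  obtain ⟨l, hl, hlen⟩ := D.exists_length_eq_wordLength w
  rcases l.eq_nil_or_concat with rfl | ⟨l, j, rfl⟩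
  · rw [← hl, wordProd_nil, act_one]
    exact D.simpleRoot_mem_posCone i
  have hj : w * D.s j = D.wordProd l := by
    rw [← hl, wordProd_concat, mul_s_mul_s]
  have hjl : D.wordLength (w * D.s j) + 1 ≤ D.wordLength w := by
    rw [hj, ← hlen, List.length_concat]
    exact Nat.succ_le_succ (D.wordLength_wordProd_le l)
  have hij : i ≠ j := by
    rintro rfl
    omega
  have hle : ∀ (v : D.weylGroup) (n : ℕ) (x y : I),
      D.wordLength (v * D.wordProd (alternatingWord x y n)) ≤ D.wordLength v + n := by
    intro v n x y
    refine (D.wordLength_mul_le _ _).trans (Nat.add_le_add_left ?_ _)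
    exact (D.wordLength_wordProd_le _).trans_eq (length_alternatingWord x y n)
  let S : ℕ → Prop := fun n => ∃ v : D.weylGroup,
    w = v * D.wordProd (alternatingWord i j n) ∧ D.wordLength w = D.wordLength v + n
  have hSb : ∀ n, S n → n ≤ L := by
    rintro n ⟨v, -, hv⟩
    omega
  have hS1 : S 1 := by
    have e : w = w * D.s j * D.wordProd (alternatingWord i j 1) := by
      simp [alternatingWord, mul_s_mul_s]
    refine ⟨w * D.s j, e, ?_⟩
    have := hle (w * D.s j) 1 i j
    rw [← e] at this
    omega
  obtain ⟨k, hk⟩ : ∃ k, Nat.findGreatest S L = k + 1 :=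
    Nat.exists_eq_add_of_le' (Nat.le_findGreatest (hSb 1 hS1) hS1)
  obtain ⟨v, hwv, hlv⟩ : S (k + 1) := hk ▸ Nat.findGreatest_spec (hSb 1 hS1) hS1
  have hmax : ¬S (k + 2) := fun h2 => by
    have := Nat.le_findGreatest (hSb _ h2) h2
    omega
  -- If the next alternating letter shortened `v`, it could be moved into the alternating factor,
  -- against maximality.
  have hy : D.wordLength v ≤ D.wordLength (v * D.s (if Even (k + 1) then j else i)) := by
    by_contra hlt
    refine hmax ⟨v * D.s (if Even (k + 1) then j else i), ?_, ?_⟩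
    · rw [alternatingWord_succ', wordProd_cons, ← mul_assoc, mul_s_mul_s, ← hwv]
    · have := hle (v * D.s (if Even (k + 1) then j else i)) (k + 2) i j
      rw [alternatingWord_succ', wordProd_cons, ← mul_assoc, mul_s_mul_s, ← hwv] at this
      omega
  -- The other letter is the first one of the alternating factor; absorbing it into `v` cannot
  -- shorten `v`, because the lengths add up to that of `w`.
  have hx : D.wordLength v ≤ D.wordLength (v * D.s (if Even k then j else i)) := by
    have := hle (v * D.s (if Even k then j else i)) k i j
    rw [mul_assoc, ← wordProd_cons, ← alternatingWord_succ', ← hwv] at this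
    omega
  have hvi : D.wordLength v ≤ D.wordLength (v * D.s i) ∧
      D.wordLength v ≤ D.wordLength (v * D.s j) := by
    by_cases hk : Even k <;> simp only [hk, Nat.even_add_one, not_true_eq_false,
      not_false_eq_true, if_true, if_false] at hx hy
    · exact ⟨hy, hx⟩
    · exact ⟨hx, hy⟩
  have hn : k + 1 ≤ D.wordLength (D.wordProd (alternatingWord j i (k + 1 + 1))) := by
    rw [hwv, mul_assoc, ← wordProd_concat, ← alternatingWord_succ, ← hwv] at h
    have := D.wordLength_mul_le v (D.wordProd (alternatingWord j i (k + 1 + 1)))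
    omega
  obtain ⟨h1, h2⟩ := D.altCoeff_nonneg hij hn
  rw [hwv, act_mul, act_alternatingWord, act_add, act_zsmul, act_zsmul]
  exact add_mem (D.zsmul_mem_posCone h1 (ih _ (by omega) v i hvi.1 rfl))
    (D.zsmul_mem_posCone h2 (ih _ (by omega) v j hvi.2 rfl))

theorem act_simpleRoot_mem_realRoots (w : D.weylGroup) (i : I) :
    D.act w (D.simpleRoot i) ∈ D.realRoots := ⟨w, i, rfl⟩

theorem act_mem_realRoots (w : D.weylGroup) {β : Module.Dual ℤ P} (h : β ∈ D.realRoots) :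
    D.act w β ∈ D.realRoots := by
  obtain ⟨u, i, rfl⟩ := h
  exact ⟨w * u, i, (D.act_mul _ _ _).symm⟩

theorem neg_mem_realRoots {β : Module.Dual ℤ P} (h : β ∈ D.realRoots) : -β ∈ D.realRoots := by
  obtain ⟨w, i, rfl⟩ := h
  exact ⟨w * D.s i, i, by rw [act_mul, act_s_simpleRoot, act_neg]⟩

theorem mem_posRoots_or_neg {β : Module.Dual ℤ P} (h : β ∈ D.realRoots) :
    β ∈ D.posRoots ∨ -β ∈ D.posRoots := by
  have hneg := D.neg_mem_realRoots h
  obtain ⟨w, i, rfl⟩ := h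
  rcases le_total (D.wordLength w) (D.wordLength (w * D.s i)) with h | h
  · exact Or.inl ⟨⟨w, i, rfl⟩, D.act_simpleRoot_mem_posCone w i h⟩
  · refine Or.inr ⟨hneg, ?_⟩
    have := D.act_simpleRoot_mem_posCone (w * D.s i) i (by rwa [mul_s_mul_s])
    rwa [act_mul, act_s_simpleRoot, act_neg] at this

end KMRootDatum

namespace KMRootDatum

variable {I : Type u} {P : Type v} [AddCommGroup P] (D : KMRootDatum I P)

/-! ### Coefficients of roots -/

theorem exists_coeff_of_mem_posCone {β : Module.Dual ℤ P} (h : β ∈ D.posCone) :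
    ∃ f : I →₀ ℤ, 0 ≤ f ∧ Finsupp.linearCombination ℤ D.simpleRoot f = β := by
  induction h using AddSubmonoid.closure_induction with
  | mem x hx =>
    obtain ⟨i, rfl⟩ := hx
    exact ⟨Finsupp.single i 1, Finsupp.single_nonneg.mpr zero_le_one, by simp⟩
  | zero => exact ⟨0, le_rfl, map_zero _⟩
  | add x y _ _ ihx ihy =>
    obtain ⟨f, hf, rfl⟩ := ihx
    obtain ⟨g, hg, rfl⟩ := ihy
    exact ⟨f + g, add_nonneg hf hg, map_add _ _ _⟩

theorem simpleRoot_ne_zero (i : I) : D.simpleRoot i ≠ 0 := fun h => by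
  have := D.root_coroot_two i
  simp [h] at this

theorem ne_zero_of_mem_realRoots {β : Module.Dual ℤ P} (h : β ∈ D.realRoots) : β ≠ 0 := by
  obtain ⟨w, i, rfl⟩ := h
  intro h
  apply D.simpleRoot_ne_zero i
  rw [← D.act_inv_act w (D.simpleRoot i), h]
  rfl

theorem neg_notMem_posRoots {β : Module.Dual ℤ P} (h : β ∈ D.posRoots) : -β ∉ D.posRoots := by
  intro h'
  obtain ⟨f, hf, hfβ⟩ := D.exists_coeff_of_mem_posCone h.2
  obtain ⟨g, hg, hgβ⟩ := D.exists_coeff_of_mem_posCone h'.2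
  have hfg : f + g = 0 := D.linearIndependent_root (by rw [map_add, hfβ, hgβ, map_zero]; abel)
  have hf0 : f = 0 := by
    ext j
    have h1 := DFunLike.congr_fun hfg j
    have h2 := hf j
    have h3 := hg j
    simp only [Finsupp.add_apply, Finsupp.coe_zero, Pi.zero_apply] at h1 h2 h3 ⊢
    omega
  exact D.ne_zero_of_mem_realRoots h.1 (by rw [← hfβ, hf0, map_zero])

theorem simpleRoot_mem_posRoots (i : I) : D.simpleRoot i ∈ D.posRoots :=
  ⟨⟨1, i, (D.act_one _).symm⟩, D.simpleRoot_mem_posCone i⟩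

theorem exists_coeff_of_mem_realRoots {β : Module.Dual ℤ P} (h : β ∈ D.realRoots) :
    ∃ f : I →₀ ℤ, Finsupp.linearCombination ℤ D.simpleRoot f = β := by
  rcases D.mem_posRoots_or_neg h with h | h
  · obtain ⟨f, -, hf⟩ := D.exists_coeff_of_mem_posCone h.2
    exact ⟨f, hf⟩
  · obtain ⟨f, -, hf⟩ := D.exists_coeff_of_mem_posCone h.2
    exact ⟨-f, by rw [map_neg, hf, neg_neg]⟩

/-- Transporting the multiple to a simple root `α_j` and comparing coefficients of `α_j` shows that
`k` divides 1, as real roots have integral coefficients. -/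
theorem eq_simpleRoot_of_mem_realRoots {k : ℤ} {i : I} (hk : 0 ≤ k)
    (h : k • D.simpleRoot i ∈ D.realRoots) : k • D.simpleRoot i = D.simpleRoot i := by
  obtain ⟨w, j, hj⟩ := h
  obtain ⟨f, hf⟩ := D.exists_coeff_of_mem_realRoots (D.act_simpleRoot_mem_realRoots w⁻¹ i)
  have e : D.simpleRoot j = k • D.act w⁻¹ (D.simpleRoot i) := by
    rw [← act_zsmul, hj, act_inv_act]
  have e' : Finsupp.single j 1 = k • f :=
    D.linearIndependent_root (by rw [map_smul, hf, ← e]; simp)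
  have e'' : k * f j = 1 := by simpa using (DFunLike.congr_fun e' j).symm
  rcases Int.eq_one_or_neg_one_of_mul_eq_one e'' with rfl | rfl
  · exact one_smul _ _
  · omega

/-- A simple reflection permutes the positive real roots other than its simple root. -/
theorem act_s_mem_posRoots {i : I} {β : Module.Dual ℤ P} (h : β ∈ D.posRoots)
    (hi : β ≠ D.simpleRoot i) : D.act (D.s i) β ∈ D.posRoots := by
  rcases D.mem_posRoots_or_neg (D.act_mem_realRoots (D.s i) h.1) with h' | h'
  · exact h'
  exfalso
  apply hi
  obtain ⟨f, hf, hfβ⟩ := D.exists_coeff_of_mem_posCone h.2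
  obtain ⟨g, hg, hgβ⟩ := D.exists_coeff_of_mem_posCone h'.2
  -- If `β` and `-s_i(β)` are both positive, their sum is a multiple of `α_i`; nonnegativity then
  -- leaves `β` no coefficient other than that of `α_i`.
  have e : f + g = Finsupp.single i (β (D.simpleCoroot i)) := by
    apply D.linearIndependent_root
    rw [map_add, hfβ, hgβ, act_s]
    simp
  have hfi : f = Finsupp.single i (f i) := by
    ext j
    by_cases hj : j = i
    · rw [hj, Finsupp.single_eq_same]
    · have h1 := DFunLike.congr_fun e j
      have h2 := hf j
      have h3 := hg j
      rw [Finsupp.single_eq_of_ne hj] at h1 ⊢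
      simp only [Finsupp.add_apply, Finsupp.coe_zero, Pi.zero_apply] at h1 h2 h3 ⊢
      omega
  have hβ : β = f i • D.simpleRoot i := by
    rw [← hfβ]
    nth_rewrite 1 [hfi]
    simp
  have hr := h.1
  rw [hβ] at hr ⊢
  exact D.eq_simpleRoot_of_mem_realRoots (hf i) hr

theorem act_s_ne_simpleRoot {i : I} {β : Module.Dual ℤ P} (h : β ≠ -D.simpleRoot i) :
    D.act (D.s i) β ≠ D.simpleRoot i := fun e => h <| by
  rw [← D.act_s_act_s i β, e, act_s_simpleRoot]

theorem act_s_mem_posRoots_iff {i : I} {β : Module.Dual ℤ P} (h : β ≠ D.simpleRoot i)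
    (h' : β ≠ -D.simpleRoot i) : D.act (D.s i) β ∈ D.posRoots ↔ β ∈ D.posRoots := by
  refine ⟨fun hβ => ?_, fun hβ => D.act_s_mem_posRoots hβ h⟩
  rw [← D.act_s_act_s i β]
  exact D.act_s_mem_posRoots hβ (D.act_s_ne_simpleRoot h')

theorem bijOn_act_s (i : I) :
    Set.BijOn (D.act (D.s i)) (D.posRoots \ {D.simpleRoot i}) (D.posRoots \ {D.simpleRoot i}) := by
  have hmaps : Set.MapsTo (D.act (D.s i)) (D.posRoots \ {D.simpleRoot i})
      (D.posRoots \ {D.simpleRoot i}) := by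
    rintro β ⟨hβ, hne⟩
    refine ⟨D.act_s_mem_posRoots hβ hne, D.act_s_ne_simpleRoot ?_⟩
    rintro rfl
    exact D.neg_notMem_posRoots (D.simpleRoot_mem_posRoots i) hβ
  exact Set.InvOn.bijOn ⟨fun β _ => D.act_s_act_s i β, fun β _ => D.act_s_act_s i β⟩ hmaps hmaps

/-! ### Inversion sets -/

theorem mem_inv_inv {w : D.weylGroup} {η : Module.Dual ℤ P} :
    η ∈ D.inv w⁻¹ ↔ η ∈ D.posRoots ∧ -D.act w⁻¹ η ∈ D.posRoots := Iff.rfl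

/-- A positive `η` is an inversion of `u⁻¹` when `u⁻¹(η)` is negative, and applying `s_i` changes
the sign of no root except `±α_i`. -/
theorem inv_mul_s {u : D.weylGroup} {i : I} (h : D.act u (D.simpleRoot i) ∈ D.posRoots) :
    D.inv (u * D.s i)⁻¹ = insert (D.act u (D.simpleRoot i)) (D.inv u⁻¹) := by
  have hsi := D.simpleRoot_mem_posRoots i
  ext η
  rw [Set.mem_insert_iff, mem_inv_inv, mem_inv_inv, mul_inv_rev, s_inv, act_mul]
  by_cases h1 : η = D.act u (D.simpleRoot i)
  · subst h1
    simp only [act_inv_act, act_s_simpleRoot, neg_neg, hsi, h, true_or, and_self]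
  · rw [← act_neg]
    by_cases h2 : D.act u⁻¹ η = -D.simpleRoot i
    · have : η = -D.act u (D.simpleRoot i) := by
        rw [← D.act_act_inv u η, h2, act_neg]
      have hη : η ∉ D.posRoots := this ▸ D.neg_notMem_posRoots h
      simp only [h1, hη, false_and, or_self]
    · rw [D.act_s_mem_posRoots_iff, or_iff_right h1]
      · rwa [Ne, neg_eq_iff_eq_neg]
      · rw [Ne, neg_inj]
        exact fun e => h1 (by rw [← e, act_act_inv])

theorem simpleRoot_notMem_inv (u : D.weylGroup) (i : I) :
    D.act u (D.simpleRoot i) ∉ D.inv u⁻¹ := fun h => by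
  have := h.2
  rw [act_inv_act] at this
  exact D.neg_notMem_posRoots (D.simpleRoot_mem_posRoots i) this

theorem neg_act_simpleRoot (u : D.weylGroup) (i : I) :
    D.act (u * D.s i) (D.simpleRoot i) = -D.act u (D.simpleRoot i) := by
  rw [act_mul, act_s_simpleRoot, act_neg]

theorem inv_eq_insert {u : D.weylGroup} {i : I} (h : -D.act u (D.simpleRoot i) ∈ D.posRoots) :
    D.inv u⁻¹ = insert (-D.act u (D.simpleRoot i)) (D.inv (u * D.s i)⁻¹) := by
  have := D.inv_mul_s (u := u * D.s i) (i := i) (by rwa [neg_act_simpleRoot])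
  rwa [mul_s_mul_s, neg_act_simpleRoot] at this

theorem weylGroup_induction {p : D.weylGroup → Prop} (one : p 1)
    (s_mul : ∀ i w, p w → p (D.s i * w)) (w : D.weylGroup) : p w := by
  obtain ⟨l, rfl⟩ := KMHecke.exists_word D w
  induction l with
  | nil => exact one
  | cons i l ih => exact D.wordProd_cons i l ▸ s_mul i _ ih

theorem finite_inv (w : D.weylGroup) : (D.inv w).Finite := by
  induction w using D.weylGroup_induction with
  | one =>
    refine Set.Finite.subset Set.finite_empty fun η hη => ?_
    have := hη.2
    rw [act_one] at this
    exact D.neg_notMem_posRoots hη.1 this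
  | s_mul i w ih =>
    have e : D.s i * w = (w⁻¹ * D.s i)⁻¹ := by rw [mul_inv_rev, s_inv, inv_inv]
    rw [e]
    rw [← inv_inv w] at ih
    rcases D.mem_posRoots_or_neg (D.act_simpleRoot_mem_realRoots w⁻¹ i) with h | h
    · rw [D.inv_mul_s h]
      exact ih.insert _
    · rw [D.inv_eq_insert h] at ih
      exact ih.subset (Set.subset_insert _ _)

/-! ### The Tits cone -/

theorem zero_le_of_mem_posCone {lam : P} (hlam : lam ∈ D.dominant) {β : Module.Dual ℤ P}
    (h : β ∈ D.posCone) : 0 ≤ β lam := by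
  induction h using AddSubmonoid.closure_induction with
  | mem x hx =>
    obtain ⟨i, rfl⟩ := hx
    exact hlam i
  | zero => exact le_rfl
  | add x y _ _ ihx ihy => exact add_nonneg ihx ihy

/-- The positive real roots taking a negative value at a coweight. -/
def negRoots (μ : P) : Set (Module.Dual ℤ P) :=
  {η | η ∈ D.posRoots ∧ η μ < 0}

theorem negRoots_subset_inv {lam : P} (hlam : lam ∈ D.dominant) (w : D.weylGroup) :
    D.negRoots ((w : P ≃ₗ[ℤ] P) lam) ⊆ D.inv w⁻¹ := by
  rintro η ⟨hη, hlt⟩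
  refine ⟨hη, ?_⟩
  rcases D.mem_posRoots_or_neg (D.act_mem_realRoots w⁻¹ hη.1) with h | h
  · have := D.zero_le_of_mem_posCone hlam h.2
    rw [act_apply, inv_inv] at this
    omega
  · exact h

theorem simpleRoot_reflection (i : I) (μ : P) :
    D.simpleRoot i (D.reflection i μ) = -D.simpleRoot i μ := by
  rw [← act_s_apply, act_s_simpleRoot, LinearMap.neg_apply]

/-- For the converse, reflecting in a simple root negative at `μ` removes that root and permutes the
other negative ones, so finitely many reflections reach a dominant coweight. In this form closure
under sums and under root strings is immediate. -/
theorem mem_titsCone_iff {μ : P} : μ ∈ D.titsCone ↔ (D.negRoots μ).Finite := by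
  constructor
  · rintro ⟨w, lam, hlam, rfl⟩
    exact (D.finite_inv w⁻¹).subset (D.negRoots_subset_inv hlam w)
  · intro hfin
    induction hn : (D.negRoots μ).ncard using Nat.strong_induction_on generalizing μ with
    | _ n ih =>
    by_cases hdom : μ ∈ D.dominant
    · exact ⟨1, μ, hdom, rfl⟩
    obtain ⟨i, hi⟩ : ∃ i, D.simpleRoot i μ < 0 := by
      simpa [dominant] using hdom
    have hmem : D.simpleRoot i ∈ D.negRoots μ := ⟨D.simpleRoot_mem_posRoots i, hi⟩
    have hmaps : Set.MapsTo (D.act (D.s i)) (D.negRoots (D.reflection i μ))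
        (D.negRoots μ \ {D.simpleRoot i}) := by
      rintro η ⟨hη, hlt⟩
      have hne : η ≠ D.simpleRoot i := by
        rintro rfl
        rw [simpleRoot_reflection] at hlt
        omega
      obtain ⟨h1, h2⟩ := (D.bijOn_act_s i).mapsTo ⟨hη, hne⟩
      exact ⟨⟨h1, by rwa [act_s_apply]⟩, h2⟩
    have hinj : Set.InjOn (D.act (D.s i)) (D.negRoots (D.reflection i μ)) :=
      (Function.LeftInverse.injective (D.act_s_act_s i)).injOn
    have hfin' := hfin.subset (Set.sdiff_subset (t := {D.simpleRoot i}))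
    have hlt : (D.negRoots (D.reflection i μ)).ncard < n := by
      rw [← hn]
      exact (Set.ncard_le_ncard_of_injOn _ hmaps hinj hfin').trans_lt
        (Set.ncard_sdiff_singleton_lt_of_mem hmem hfin)
    obtain ⟨w, lam, hlam, e⟩ := ih _ hlt (Set.Finite.of_injOn hmaps hinj hfin') rfl
    refine ⟨D.s i * w, lam, hlam, ?_⟩
    rw [Subgroup.coe_mul, LinearEquiv.mul_apply, ← e, coe_s, reflection_reflection]

theorem zero_mem_titsCone : (0 : P) ∈ D.titsCone :=
  ⟨1, 0, fun i => by rw [map_zero], (map_zero _).symm⟩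

theorem dominant_subset_titsCone : D.dominant ⊆ D.titsCone :=
  fun lam h => ⟨1, lam, h, rfl⟩

theorem add_mem_titsCone {μ ν : P} (hμ : μ ∈ D.titsCone) (hν : ν ∈ D.titsCone) :
    μ + ν ∈ D.titsCone := by
  rw [mem_titsCone_iff] at *
  refine (hμ.union hν).subset fun η hη => ?_
  obtain ⟨hp, hlt⟩ := hη
  rw [map_add] at hlt
  rcases lt_or_ge (η μ) 0 with h | h
  · exact Or.inl ⟨hp, h⟩
  · exact Or.inr ⟨hp, by omega⟩

theorem reflection_mem_titsCone (i : I) {μ : P} (hμ : μ ∈ D.titsCone) :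
    D.reflection i μ ∈ D.titsCone := by
  obtain ⟨w, lam, hlam, rfl⟩ := hμ
  exact ⟨D.s i * w, lam, hlam, rfl⟩

/-- The Tits cone contains the `α_i^∨`-string from `μ` to `s_i(μ)`. -/
theorem sub_mem_titsCone (i : I) {μ : P} (hμ : μ ∈ D.titsCone) {k : ℕ}
    (hk : (k : ℤ) ≤ D.simpleRoot i μ) : μ - k • D.simpleCoroot i ∈ D.titsCone := by
  have hμ' := D.reflection_mem_titsCone i hμ
  rw [mem_titsCone_iff] at *
  refine (hμ.union hμ').subset fun η hη => ?_
  obtain ⟨hp, hlt⟩ := hη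
  rcases lt_or_ge (η μ) 0 with h | h
  · exact Or.inl ⟨hp, h⟩
  · refine Or.inr ⟨hp, ?_⟩
    rw [reflection_apply]
    simp only [map_sub, map_nsmul, map_zsmul, nsmul_eq_mul, smul_eq_mul] at hlt ⊢
    -- Along the string `η` is affine in `k`. Being nonnegative at `μ` and negative later, it
    -- decreases, so it is still negative at the far end `s_i μ`.
    have hc : 0 ≤ η (D.simpleCoroot i) := by
      by_contra hc
      nlinarith
    nlinarith

/-! ### The length function -/

/-- The sum of `max(0, -⟨η, μ⟩)` over the positive real roots `η`. -/
def negSum (μ : P) : ℤ :=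
  ∑ᶠ η ∈ D.posRoots, max 0 (-(η μ))

theorem posRoots_inter_support_subset (μ : P) :
    D.posRoots ∩ Function.support (fun η : Module.Dual ℤ P => max 0 (-(η μ))) ⊆ D.negRoots μ := by
  rintro η ⟨hη, hne⟩
  refine ⟨hη, ?_⟩
  rw [Function.mem_support] at hne
  omega

theorem negSum_eq (i : I) {μ : P} (hμ : μ ∈ D.titsCone) :
    D.negSum μ = max 0 (-D.simpleRoot i μ) +
      ∑ᶠ η ∈ D.posRoots \ {D.simpleRoot i}, max 0 (-(η μ)) := by
  rw [negSum]
  conv_lhs => rw [← Set.insert_sdiff_self_of_mem (D.simpleRoot_mem_posRoots i)]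
  refine finsum_mem_insert' _ (fun h => h.2 rfl) ?_
  exact (D.mem_titsCone_iff.mp hμ).subset ((Set.inter_subset_inter_left _ Set.sdiff_subset).trans
    (D.posRoots_inter_support_subset μ))

/-- The terms of the roots other than `α_i` are permuted, and the term of `α_i` changes by `max 0 a
- max 0 (-a) = a`. -/
theorem negSum_reflection (i : I) {μ : P} (hμ : μ ∈ D.titsCone) :
    D.negSum (D.reflection i μ) = D.negSum μ + D.simpleRoot i μ := by
  have e : ∑ᶠ η ∈ D.posRoots \ {D.simpleRoot i}, max 0 (-(η (D.reflection i μ))) =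
      ∑ᶠ η ∈ D.posRoots \ {D.simpleRoot i}, max 0 (-(η μ)) :=
    finsum_mem_eq_of_bijOn (D.act (D.s i)) (D.bijOn_act_s i) fun η _ => by rw [act_s_apply]
  rw [D.negSum_eq i hμ, D.negSum_eq i (D.reflection_mem_titsCone i hμ), e, simpleRoot_reflection]
  omega

theorem negSum_of_mem_dominant {lam : P} (h : lam ∈ D.dominant) : D.negSum lam = 0 := by
  refine finsum_mem_eq_zero_of_forall_eq_zero fun η hη => ?_
  have := D.zero_le_of_mem_posCone h hη.2
  omega

/-- The sum of the signs of `⟨η, μ⟩` over `η ∈ Inv(w⁻¹)`, where `0` has positive sign. -/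
def signSum (μ : P) (w : D.weylGroup) : ℤ :=
  ∑ᶠ η ∈ D.inv w⁻¹, if η μ < 0 then -1 else 1

theorem signSum_one (μ : P) : D.signSum μ 1 = 0 := by
  refine finsum_mem_eq_zero_of_forall_eq_zero fun η hη => ?_
  have := hη.2
  rw [inv_one, act_one] at this
  exact absurd this (D.neg_notMem_posRoots hη.1)

/-- If `u(α_i)` is positive, it joins the inversion set with its sign at `μ`. If it is negative,
`-u(α_i)` leaves the set and its sign is subtracted. The weak and strict inequalities defining
positive affine roots match the convention that 0 has positive sign. -/
theorem signSum_mul_s (μ : P) (u : D.weylGroup) (i : I) :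
    D.signSum μ (u * D.s i) = D.signSum μ u + KMHecke.sgn D μ u i := by
  classical
  have hsgn : KMHecke.sgn D μ u i =
      if (D.act u (D.simpleRoot i) ∈ D.posRoots ∧ 0 ≤ D.act u (D.simpleRoot i) μ) ∨
        (-D.act u (D.simpleRoot i) ∈ D.posRoots ∧ 0 < D.act u (D.simpleRoot i) μ)
      then 1 else -1 := by
    exact if_congr (by simp only [affineAct, posAffineRoots, Set.mem_ofPred_eq, zero_add]) rfl rfl
  rw [hsgn]
  rcases D.mem_posRoots_or_neg (D.act_simpleRoot_mem_realRoots u i) with h | h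
  · have h' := D.neg_notMem_posRoots h
    rw [signSum, D.inv_mul_s h,
      finsum_mem_insert _ (D.simpleRoot_notMem_inv u i) (D.finite_inv _), ← signSum]
    simp only [h, h', true_and, false_and, or_false]
    split_ifs <;> omega
  · have h' := D.neg_notMem_posRoots h
    rw [neg_neg] at h'
    have hn := D.simpleRoot_notMem_inv (u * D.s i) i
    rw [neg_act_simpleRoot] at hn
    rw [show D.signSum μ u = ∑ᶠ η ∈ D.inv u⁻¹, if η μ < 0 then -1 else 1 from rfl,
      D.inv_eq_insert h, finsum_mem_insert _ hn (D.finite_inv _),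
      ← signSum]
    simp only [h, h', true_and, false_and, false_or, LinearMap.neg_apply]
    split_ifs <;> omega

/-- Each summand is `2 max(0, -⟨η,μ⟩)` plus, at an inversion, the sign of `⟨η,μ⟩`. Membership in the
Tits cone gives the finite supports needed to split the `finsum`. -/
theorem finsum_lengthTerm {μ : P} (hμ : μ ∈ D.titsCone) (w : D.weylGroup) :
    ∑ᶠ η ∈ D.posRoots, D.lengthTerm μ w η = 2 * D.negSum μ + D.signSum μ w := by
  classical
  have e1 : D.signSum μ w =
      ∑ᶠ η ∈ D.posRoots, if η ∈ D.inv w⁻¹ then (if η μ < 0 then -1 else 1) else 0 := by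
    rw [signSum, finsum_mem_def, finsum_mem_def]
    refine finsum_congr fun η => ?_
    by_cases h : η ∈ D.inv w⁻¹
    · simp [h, h.1]
    · simp [h, Set.indicator_apply]
  have hfin := (D.mem_titsCone_iff.mp hμ).subset (D.posRoots_inter_support_subset μ)
  rw [e1, two_mul, negSum, ← finsum_mem_add_distrib' hfin hfin, ← finsum_mem_add_distrib']
  · refine finsum_mem_congr rfl fun η _ => ?_
    rw [lengthTerm]
    split_ifs <;> omega
  · refine hfin.subset (Set.inter_subset_inter_right _ fun η hη => ?_)
    rw [Function.mem_support] at hη ⊢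
    omega
  · refine (D.finite_inv w⁻¹).subset fun η hη => ?_
    by_contra h
    exact hη.2 (if_neg h)

variable {D}

/-- Under `s_i` the value of `ρ` drops by `⟨α_i,μ⟩` and `negSum` grows by the same amount; at a
dominant coweight `negSum` vanishes. -/
theorem RhoChoice.ρ_add_negSum (R : D.RhoChoice) {lam : P} (h : lam ∈ D.dominant)
    (w : D.weylGroup) :
    R.ρ ((w : P ≃ₗ[ℤ] P) lam) + D.negSum ((w : P ≃ₗ[ℤ] P) lam) = R.ρ lam := by
  induction w using D.weylGroup_induction with
  | one => simp [D.negSum_of_mem_dominant h]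
  | s_mul i w ih =>
    rw [Subgroup.coe_mul, LinearEquiv.mul_apply, coe_s, D.negSum_reflection i ⟨w, lam, h, rfl⟩,
      reflection_apply, ← ih, map_sub, map_smul, R.ρ_coroot]
    push_cast
    simp

theorem RhoChoice.length_eq (R : D.RhoChoice) {x : D.TitsWeyl} {lam : P} (h : lam ∈ D.dominant)
    {w : D.weylGroup} (hx : x.μ = (w : P ≃ₗ[ℤ] P) lam) :
    R.length x = 2 * R.ρ lam + D.signSum x.μ x.w := by
  rw [RhoChoice.length, D.finsum_lengthTerm x.mem, ← R.ρ_add_negSum h w, ← hx]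
  push_cast
  ring

end KMRootDatum

namespace KMHecke

open KMRootDatum

variable {I : Type u} {P : Type v} [AddCommGroup P] {D : KMRootDatum I P}

/-! ### Powers of `q` -/

theorem natCast_mul_eq_floor {N : ℕ} (hN : 1 ≤ N) {r : ℚ}
    (hr : r ∈ AddSubgroup.zmultiples ((N : ℚ)⁻¹)) : (N : ℚ) * r = ⌊(N : ℚ) * r⌋ := by
  obtain ⟨k, rfl⟩ := AddSubgroup.mem_zmultiples_iff.mp hr
  have hN' : (N : ℚ) ≠ 0 := by positivity
  have : (N : ℚ) * (k • (N : ℚ)⁻¹) = k := by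
    rw [zsmul_eq_mul]
    field_simp
  rw [this, Int.floor_intCast]

theorem intCast_mem_zmultiples {N : ℕ} (hN : 1 ≤ N) (k : ℤ) :
    (k : ℚ) ∈ AddSubgroup.zmultiples ((N : ℚ)⁻¹) := by
  refine AddSubgroup.mem_zmultiples_iff.mpr ⟨k * N, ?_⟩
  have hN' : (N : ℚ) ≠ 0 := by positivity
  rw [zsmul_eq_mul]
  push_cast
  field_simp

theorem qPow_zero (N : ℕ) : qPow N 0 = 1 := by
  rw [qPow, mul_zero, Int.floor_zero, LaurentPolynomial.T_zero]

theorem qPow_add {N : ℕ} (hN : 1 ≤ N) {r s : ℚ} (hr : r ∈ AddSubgroup.zmultiples ((N : ℚ)⁻¹)) :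
    qPow N (r + s) = qPow N r * qPow N s := by
  rw [qPow, mul_add, natCast_mul_eq_floor hN hr, Int.floor_intCast_add, LaurentPolynomial.T_add]
  rfl

theorem qPow_intCast (N : ℕ) (k : ℤ) : qPow N k = LaurentPolynomial.T (N * k) := by
  rw [qPow, ← Int.cast_natCast (n := N), ← Int.cast_mul, Int.floor_intCast]

theorem qPow_one (N : ℕ) : qPow N 1 = q N := by
  rw [← Int.cast_one, qPow_intCast, mul_one, q]

theorem qPow_injOn {N : ℕ} (hN : 1 ≤ N) :
    Set.InjOn (qPow N) (AddSubgroup.zmultiples ((N : ℚ)⁻¹)) := by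
  intro r hr s hs h
  have hN' : (N : ℚ) ≠ 0 := by positivity
  have hT : ⌊(N : ℚ) * r⌋ = ⌊(N : ℚ) * s⌋ := by
    have h1 := congrArg (fun f : ℤ[T;T⁻¹] => f.coeff ⌊(N : ℚ) * s⌋) h
    by_contra hne
    simp [qPow, LaurentPolynomial.T_apply, hne] at h1
  refine mul_left_cancel₀ hN' ?_
  rw [natCast_mul_eq_floor hN hr, natCast_mul_eq_floor hN hs, hT]

/-- The geometric sum `(q - 1)(q^r + q^{r-1} + ⋯ + q^{r-n+1}) = q (q^r - q^{r-n})`. -/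
theorem sub_one_mul_sum_qPow {N : ℕ} (hN : 1 ≤ N) (r : ℚ) (n : ℕ) :
    (q N - 1) * ∑ k ∈ Finset.range n, qPow N (r - k) =
      q N * (qPow N r - qPow N (r - n)) := by
  induction n with
  | zero => simp
  | succ n ih =>
    have e : qPow N (r - n) = q N * qPow N (r - (n + 1 : ℕ)) := by
      rw [← qPow_one, ← qPow_add hN (by simpa using intCast_mem_zmultiples hN 1)]
      congr 1
      push_cast
      ring
    rw [Finset.sum_range_succ, mul_add, ih, e]
    ring

/-! ### The trivial character -/

/-- The trivial character on the free algebra. -/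
def trivFree (R : D.RhoChoice) : Free D →ₐ[ℤ[T;T⁻¹]] ℤ[T;T⁻¹] :=
  FreeAlgebra.lift ℤ[T;T⁻¹] (Sum.elim (fun _ => q R.N) fun μ => qPow R.N (R.ρ μ))

theorem trivFree_freeT (R : D.RhoChoice) (i : I) : trivFree R (freeT D i) = q R.N := by
  simp [trivFree, freeT]

theorem trivFree_freeΘ (R : D.RhoChoice) {μ : P} (hμ : μ ∈ D.titsCone) :
    trivFree R (freeΘ D μ) = qPow R.N (R.ρ μ) := by
  simp [trivFree, freeΘ, hμ]

theorem sub_one_mul_trivFree_string (R : D.RhoChoice) (i : I) {μ : P} (hμ : μ ∈ D.titsCone)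
    {n : ℕ} (hn : (n : ℤ) = D.simpleRoot i μ) :
    (q R.N - 1) * trivFree R (∑ k ∈ Finset.range n, freeΘ D (μ - k • D.simpleCoroot i)) =
      q R.N * (qPow R.N (R.ρ μ) - qPow R.N (R.ρ (D.reflection i μ))) := by
  have e : R.ρ (D.reflection i μ) = R.ρ μ - n := by
    rw [reflection_apply, ← hn, map_sub, map_smul, R.ρ_coroot]
    simp
  rw [e, ← sub_one_mul_sum_qPow R.one_le_N, map_sum]
  congr 1
  refine Finset.sum_congr rfl fun k hk => ?_
  -- Every term of the string lies in the Tits cone, so the default value 0 of `freeΘ` never enters.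
  rw [trivFree_freeΘ R (D.sub_mem_titsCone i hμ (by have := Finset.mem_range.mp hk; omega)),
    map_sub, map_nsmul, R.ρ_coroot, nsmul_one]

theorem trivFree_bernstein (R : D.RhoChoice) (i : I) {μ : P} (hμ : μ ∈ D.titsCone) :
    (q R.N - 1) * trivFree R (bernsteinQuotient D i μ) =
      q R.N * (qPow R.N (R.ρ μ) - qPow R.N (R.ρ (D.reflection i μ))) := by
  rw [bernsteinQuotient, map_sub, mul_sub]
  rcases le_total 0 (D.simpleRoot i μ) with h | h
  · rw [sub_one_mul_trivFree_string R i hμ (Int.toNat_of_nonneg h),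
      Int.toNat_of_nonpos (neg_nonpos.mpr h)]
    simp
  · rw [sub_one_mul_trivFree_string R i (D.reflection_mem_titsCone i hμ)
      (by rw [simpleRoot_reflection]; exact Int.toNat_of_nonneg (neg_nonneg.mpr h)),
      Int.toNat_of_nonpos h, reflection_reflection]
    simp only [Finset.range_zero, Finset.sum_empty, map_zero, mul_zero]
    ring

theorem trivFree_prod_freeT (R : D.RhoChoice) (l : List I) :
    trivFree R (l.map (freeT D)).prod = q R.N ^ l.length := by
  induction l with
  | nil => simp
  | cons i l ih =>
    rw [List.map_cons, List.prod_cons, map_mul, trivFree_freeT, ih, List.length_cons, pow_succ']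

theorem trivFree_rel (R : D.RhoChoice) {a b : Free D} (h : Rel D R.N a b) :
    trivFree R a = trivFree R b := by
  cases h with
  | quadratic i =>
    simp only [map_mul, map_add, map_smul, map_one, trivFree_freeT, smul_eq_mul]
    ring
  | braid i j => simp only [trivFree_prod_freeT, CoxeterSystem.length_alternatingWord]
  | theta_zero => rw [trivFree_freeΘ R D.zero_mem_titsCone, map_zero, qPow_zero, map_one]
  | theta_add μ ν hμ hν =>
    rw [map_mul, trivFree_freeΘ R hμ, trivFree_freeΘ R hν,
      trivFree_freeΘ R (D.add_mem_titsCone hμ hν), map_add, qPow_add R.one_le_N (R.ρ_mem μ)]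
  | bernstein i μ hμ =>
    rw [map_sub, map_mul, map_mul, map_smul, smul_eq_mul, trivFree_freeT, trivFree_freeΘ R hμ,
      trivFree_freeΘ R (D.reflection_mem_titsCone i hμ), trivFree_bernstein R i hμ]
    ring

/-- The trivial character of the Kac-Moody affine Hecke algebra. -/
def triv (R : D.RhoChoice) : Hecke D R.N →ₐ[ℤ[T;T⁻¹]] ℤ[T;T⁻¹] :=
  RingQuot.liftAlgHom ℤ[T;T⁻¹] ⟨trivFree R, fun _ _ h => trivFree_rel R h⟩

theorem triv_heckeT (R : D.RhoChoice) (i : I) : triv R (heckeT D R.N i) = q R.N := by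
  rw [triv, heckeT, RingQuot.liftAlgHom_mkAlgHom_apply, trivFree_freeT]

theorem triv_heckeΘ (R : D.RhoChoice) {μ : P} (hμ : μ ∈ D.titsCone) :
    triv R (heckeΘ D R.N μ) = qPow R.N (R.ρ μ) := by
  rw [triv, heckeΘ, RingQuot.liftAlgHom_mkAlgHom_apply, trivFree_freeΘ R hμ]

theorem eq_triv (R : D.RhoChoice) {φ : Hecke D R.N →ₐ[ℤ[T;T⁻¹]] ℤ[T;T⁻¹]}
    (hT : ∀ i : I, φ (heckeT D R.N i) = q R.N)
    (hΘ : ∀ μ ∈ D.titsCone, φ (heckeΘ D R.N μ) = qPow R.N (R.ρ μ)) : φ = triv R := by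
  refine RingQuot.ringQuot_ext' _ _ _ (FreeAlgebra.hom_ext (funext fun x => ?_))
  rcases x with i | ⟨μ, hμ⟩
  · exact (hT i).trans (triv_heckeT R i).symm
  · have e : FreeAlgebra.ι ℤ[T;T⁻¹] (Sum.inr ⟨μ, hμ⟩) = freeΘ D μ := by simp [freeΘ, hμ]
    simp only [Function.comp_apply, e]
    exact (hΘ μ hμ).trans (triv_heckeΘ R hμ).symm

/-! ### Values of the trivial character on the `T`-basis -/

theorem triv_unitT_zpow (R : D.RhoChoice) (i : I) {e : ℤ} (he : e = 1 ∨ e = -1) :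
    triv R ((unitT D R.N i ^ e : (Hecke D R.N)ˣ) : Hecke D R.N) = qPow R.N e := by
  rcases he with rfl | rfl
  · rw [zpow_one, Int.cast_one, qPow_one]
    exact triv_heckeT R i
  · have h1 : triv R ((unitT D R.N i ^ (-1 : ℤ) : (Hecke D R.N)ˣ) : Hecke D R.N) =
        qInv R.N * triv R (heckeT D R.N i) + (qInv R.N - 1) := by
      rw [zpow_neg_one]
      change triv R (qInv R.N • heckeT D R.N i + (qInv R.N - 1) • 1) = _
      rw [map_add, map_smul, map_smul, map_one, smul_eq_mul, smul_eq_mul, mul_one]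
    rw [h1, triv_heckeT, qPow_intCast, mul_comm, q_mul_qInv, qInv, mul_neg_one]
    ring

theorem sgn_eq_or (μ : P) (u : D.weylGroup) (i : I) : sgn D μ u i = 1 ∨ sgn D μ u i = -1 := by
  unfold sgn
  split_ifs
  · exact Or.inl rfl
  · exact Or.inr rfl

/-- The exponents telescope through `signSum_mul_s`, so only the product of the word matters. -/
theorem triv_signedWordT (R : D.RhoChoice) (μ : P) (u : D.weylGroup) (l : List I) :
    triv R (signedWordT D R.N μ u l : (Hecke D R.N)ˣ) =
      qPow R.N ((D.signSum μ (u * D.wordProd l) - D.signSum μ u : ℤ) : ℚ) := by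
  induction l generalizing u with
  | nil => simp [signedWordT, qPow_zero]
  | cons i l ih =>
    rw [signedWordT, Units.val_mul, map_mul, triv_unitT_zpow R i (sgn_eq_or μ u i), ih,
      ← qPow_add R.one_le_N (intCast_mem_zmultiples R.one_le_N _), wordProd_cons, mul_assoc,
      signSum_mul_s]
    congr 1
    push_cast
    ring

/-- Of the two factors `q^⟨ρ,λ⟩`, one is the normalisation of `T_x` and the other is the image of
`Θ^λ`. -/
theorem triv_elem (R : D.RhoChoice) {x : D.TitsWeyl} (d : Decomposition x) :
    triv R (d.elem R) = qPow R.N (R.length x) := by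
  have hconj : triv R ((wordT D R.N d.wordInv)⁻¹ : (Hecke D R.N)ˣ) *
      triv R (wordT D R.N d.wordInv : Hecke D R.N) = 1 := by
    rw [← map_mul, Units.inv_mul, map_one]
  rw [Decomposition.elem, map_smul, smul_eq_mul, map_mul, map_mul, map_mul, triv_signedWordT,
    triv_heckeΘ R (D.dominant_subset_titsCone d.dominant), one_mul, d.word_prod, signSum_one,
    sub_zero, R.length_eq d.dominant d.μ_eq, two_mul, add_assoc,
    qPow_add R.one_le_N (R.ρ_mem _), qPow_add R.one_le_N (R.ρ_mem _)]
  linear_combination qPow R.N (R.ρ d.lam) * qPow R.N (R.ρ d.lam) *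
    qPow R.N (D.signSum x.μ x.w) * hconj

theorem length_mem_zmultiples (R : D.RhoChoice) (x : D.TitsWeyl) :
    R.length x ∈ AddSubgroup.zmultiples ((R.N : ℚ)⁻¹) := by
  rw [RhoChoice.length, two_mul]
  exact add_mem (add_mem (R.ρ_mem _) (R.ρ_mem _)) (intCast_mem_zmultiples R.one_le_N _)

end KMHecke

end

theorem theorem3p1 {I : Type*} {P : Type*} [AddCommGroup P] [Module.Free ℤ P] [Module.Finite ℤ P]
    (D : KMRootDatum I P) (R : D.RhoChoice) :
    ∃ triv : KMHecke.Hecke D R.N →ₐ[LaurentPolynomial ℤ] LaurentPolynomial ℤ,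
      -- values on the generators
      (∀ i : I, triv (KMHecke.heckeT D R.N i) = KMHecke.q R.N) ∧
      (∀ μ ∈ D.titsCone, triv (KMHecke.heckeΘ D R.N μ) = KMHecke.qPow R.N (R.ρ μ)) ∧
      -- these values determine the algebra map
      (∀ φ : KMHecke.Hecke D R.N →ₐ[LaurentPolynomial ℤ] LaurentPolynomial ℤ,
        (∀ i : I, φ (KMHecke.heckeT D R.N i) = KMHecke.q R.N) →
        (∀ μ ∈ D.titsCone, φ (KMHecke.heckeΘ D R.N μ) = KMHecke.qPow R.N (R.ρ μ)) →
        φ = triv) ∧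
      -- the `T`-basis element `T_x` is sent to `q^{ℓ(x)}`, and also any expression for `T_x` is
      (∀ x : D.TitsWeyl,
        R.length x ∈ AddSubgroup.zmultiples ((R.N : ℚ)⁻¹) ∧
        triv (KMHecke.basisT R x) = KMHecke.qPow R.N (R.length x) ∧
        (∀ d : KMHecke.Decomposition x, triv (d.elem R) = KMHecke.qPow R.N (R.length x)) ∧
        -- the length is recovered from the image of `T_x`
        (∀ r ∈ AddSubgroup.zmultiples ((R.N : ℚ)⁻¹),
          triv (KMHecke.basisT R x) = KMHecke.qPow R.N r → r = R.length x)) := by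
  refine ⟨KMHecke.triv R, KMHecke.triv_heckeT R, fun μ hμ => KMHecke.triv_heckeΘ R hμ,
    fun φ hT hΘ => KMHecke.eq_triv R hT hΘ, fun x => ⟨KMHecke.length_mem_zmultiples R x,
      KMHecke.triv_elem R _, KMHecke.triv_elem R, fun r hr h => ?_⟩⟩
  exact KMHecke.qPow_injOn R.one_le_N hr (KMHecke.length_mem_zmultiples R x)
    (h.symm.trans (KMHecke.triv_elem R _))
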